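/- Let $\Bbbk$ be a field and let $\mathfrak g$ be a (right) Leibniz algebra over $\Bbbk$, i.e. a $\Bbbk$-vector space with a bilinear product satisfying $x(yz)=(xy)z-(xz)y$. Let $\mathfrak g_{\mathrm{Lie}}=\mathfrak g/\langle x^2\mid x\in\mathfrak g\rangle_\Bbbk$ be the associated Lie algebra, with quotient map $x\mapsto\overline{x}$, and let $\mathrm{Mod}^{\mathsf{Lie}}_{\mathfrak g_{\mathrm{Lie}}}$ be the category of right $\mathfrak g_{\mathrm{Lie}}$-modules. Let $\mathrm{Mod}^{\mathsf{Leib}}_{\mathfrak g}$ be the (abelian) category of $\mathfrak g$-modules, i.e. vector spaces $M$ with bilinear left and right actions of $\mathfrak g$ such that $m(xy)=(mx)y-(my)x$, $x(my)=(xm)y-(xy)m$ and $x(ym)=(xy)m-(xm)y$ for all $x,y\in\mathfrak g$, $m\in M$. Let $(-)^{\mathrm{asinv}}:\mathrm{Mod}^{\mathsf{Leib}}_{\mathfrak g}\to\mathrm{Mod}^{\mathsf{Lie}}_{\mathfrak g_{\mathrm{Lie}}}$ be the left exact functor $M\mapsto\{m\in M\mid xm=0\ \forall x\in\mathfrak g\}$,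 with the right action inherited from $M$ (the right adjoint of the functor that equips a right $\mathfrak g_{\mathrm{Lie}}$-module with the zero left action), and let $\mathbb R^*(-)^{\mathrm{asinv}}$ denote its right derived functors. For a right $\mathfrak g_{\mathrm{Lie}}$-module $N$, let $\mathrm{rext}(N)$ be the $\mathfrak g$-module $N\oplus\hom_\Bbbk(\mathfrak g,N)$ with $$(n,f)x=(n\overline{x},fx),\qquad x(n,f)=(f(x),-fx),\qquad\text{where }(fx)(y)=f(y)\overline{x}-f(yx).$$ Then there are isomorphisms of right $\mathfrak g_{\mathrm{Lie}}$-modules, natural in $N$, $$\mathbb R^n(-)^{\mathrm{asinv}}\,\mathrm{rext}(N)\cong\begin{cases}N & n=0\\ 0 & n>0.\end{cases}$$ -/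

import Mathlib

open CategoryTheory

universe u

/-! ### Leibniz algebras and the associated Lie algebra -/

/-- A (right) Leibniz algebra over `k`: a `k`-vector space with a bilinear product satisfying
`x(yz) = (xy)z - (xz)y`. -/
class LeibnizAlgebra (k g : Type u) [Field k] [AddCommGroup g] [Module k g] where
  /-- The product `x, y ↦ xy`. -/
  mul : g →ₗ[k] g →ₗ[k] g
  leibniz : ∀ x y z : g, mul x (mul y z) = mul (mul x y) z - mul (mul x z) y

namespace LeibnizAlgebra

variable (k g : Type u) [Field k] [AddCommGroup g] [Module k g] [LeibnizAlgebra k g]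

/-- The span of the squares `x²`. -/
def squares : Submodule k g := Submodule.span k (Set.range fun x : g => mul (k := k) x x)

variable {k g} in
theorem mul_squares (x : g) {z : g} (hz : z ∈ squares k g) : mul (k := k) x z = 0 := by
  have h : squares k g ≤ LinearMap.ker (mul (k := k) x) := by
    refine Submodule.span_le.2 ?_
    rintro _ ⟨y, rfl⟩
    simp [leibniz]
  exact h hz

theorem mul_add_mul_mem (x y : g) :
    mul (k := k) x y + mul (k := k) y x ∈ squares k g := by
  have h : mul (k := k) x y + mul (k := k) y x =
      mul (k := k) (x + y) (x + y) - mul (k := k) x x - mul (k := k) y y := by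
    simp only [map_add, LinearMap.add_apply]; abel
  rw [h]
  exact sub_mem (sub_mem (Submodule.subset_span ⟨_, rfl⟩) (Submodule.subset_span ⟨_, rfl⟩))
    (Submodule.subset_span ⟨_, rfl⟩)

variable {k g} in
theorem squares_mul {z : g} (hz : z ∈ squares k g) (x : g) :
    mul (k := k) z x ∈ squares k g := by
  have h := mul_add_mul_mem k g z x
  rwa [mul_squares x hz, add_zero] at h

/-- The Lie algebra `g_Lie = g / ⟨x²⟩`. -/
def Lie : Type u := g ⧸ squares k g

instance : AddCommGroup (Lie k g) := inferInstanceAs (AddCommGroup (g ⧸ squares k g))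
instance : Module k (Lie k g) := inferInstanceAs (Module k (g ⧸ squares k g))

/-- The canonical surjection `g → g_Lie`. -/
def toLie : g →ₗ[k] Lie k g := (squares k g).mkQ

theorem toLie_surjective : Function.Surjective (toLie k g) := (squares k g).mkQ_surjective

theorem toLie_eq_zero {z : g} : toLie k g z = 0 ↔ z ∈ squares k g :=
  Submodule.Quotient.mk_eq_zero _

/-- A linear map on `g` killing the squares induces a linear map on `g_Lie`. -/
def lieDesc {V : Type*} [AddCommGroup V] [Module k V] (f : g →ₗ[k] V)
    (hf : ∀ x, f (mul (k := k) x x) = 0) : Lie k g →ₗ[k] V :=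
  (squares k g).liftQ f (by
    refine Submodule.span_le.2 ?_
    rintro _ ⟨y, rfl⟩
    exact hf y)

@[simp]
theorem lieDesc_toLie {V : Type*} [AddCommGroup V] [Module k V] (f : g →ₗ[k] V)
    (hf : ∀ x, f (mul (k := k) x x) = 0) (x : g) : lieDesc k g f hf (toLie k g x) = f x := rfl

/-- The product induced on `g_Lie`. -/
def lieMul : Lie k g →ₗ[k] Lie k g →ₗ[k] Lie k g :=
  lieDesc k g
    (lieDesc k g ((mul (k := k) (g := g)).compr₂ (toLie k g)).flip (fun y => by
      ext x
      simp [leibniz])).flip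
    (fun x => by
      apply LinearMap.ext
      intro y
      obtain ⟨y, rfl⟩ := toLie_surjective k g y
      exact (toLie_eq_zero k g).2 (squares_mul (Submodule.subset_span ⟨x, rfl⟩) y))

instance : Bracket (Lie k g) (Lie k g) := ⟨fun x y => lieMul k g x y⟩

/-- The bracket of `g_Lie` is induced by the product of `g`. -/
theorem toLie_mul (x y : g) : ⁅toLie k g x, toLie k g y⁆ = toLie k g (mul (k := k) x y) := rfl

instance : LieRing (Lie k g) where
  add_lie x y z := by change lieMul k g _ _ = lieMul k g _ _ + lieMul k g _ _; simp
  lie_add x y z := by change lieMul k g _ _ = lieMul k g _ _ + lieMul k g _ _; simp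
  lie_self x := by
    obtain ⟨x, rfl⟩ := toLie_surjective k g x
    rw [toLie_mul, toLie_eq_zero]
    exact Submodule.subset_span ⟨x, rfl⟩
  leibniz_lie x y z := by
    obtain ⟨x, rfl⟩ := toLie_surjective k g x
    obtain ⟨y, rfl⟩ := toLie_surjective k g y
    obtain ⟨z, rfl⟩ := toLie_surjective k g z
    simp only [toLie_mul]
    rw [← map_add, ← sub_eq_zero, ← map_sub, toLie_eq_zero, leibniz]
    have h := neg_mem (mul_add_mul_mem k g (mul (k := k) x z) y)
    convert h using 1
    abel

instance : LieAlgebra k (Lie k g) where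
  lie_smul c x y := by change lieMul k g _ _ = c • lieMul k g _ _; simp

end LeibnizAlgebra

/-! ### The category of right modules over a Lie algebra -/

/-- A right module over a Lie algebra `h`: a vector space `M` with a bilinear right action
`m, x ↦ mx` such that `m[x, y] = (mx)y - (my)x`. -/
structure RightLieModule (k h : Type u) [Field k] [LieRing h] [LieAlgebra k h] where
  carrier : Type u
  [addCommGroup : AddCommGroup carrier]
  [module : Module k carrier]
  /-- The right action `m, x ↦ mx`. -/
  act : carrier →ₗ[k] h →ₗ[k] carrier
  act_lie : ∀ m x y, act m ⁅x, y⁆ = act (act m x) y - act (act m y) x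

namespace RightLieModule

variable {k h : Type u} [Field k] [LieRing h] [LieAlgebra k h]

attribute [instance] addCommGroup module

/-- A morphism of right modules: a linear map commuting with the actions. -/
@[ext]
structure Hom (M N : RightLieModule k h) where
  lin : M.carrier →ₗ[k] N.carrier
  map_act : ∀ m x, lin (M.act m x) = N.act (lin m) x

instance : Category (RightLieModule k h) where
  Hom M N := Hom M N
  id M := ⟨LinearMap.id, fun _ _ => rfl⟩
  comp f g := ⟨g.lin ∘ₗ f.lin, fun m x => by simp [f.map_act, g.map_act]⟩

@[ext]
theorem hom_ext {M N : RightLieModule k h} {f g : M ⟶ N} (w : ∀ m, f.lin m = g.lin m) : f = g :=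
  Hom.ext (LinearMap.ext w)

@[simp] theorem id_lin (M : RightLieModule k h) : Hom.lin (𝟙 M) = LinearMap.id := rfl

@[simp] theorem comp_lin {M N P : RightLieModule k h} (f : M ⟶ N) (g : N ⟶ P) :
    (f ≫ g).lin = g.lin ∘ₗ f.lin := rfl

section Preadditive

variable (M N : RightLieModule k h)

instance : Zero (M ⟶ N) := ⟨⟨0, by simp⟩⟩
instance : Add (M ⟶ N) := ⟨fun f g => ⟨f.lin + g.lin, by simp [f.map_act, g.map_act]⟩⟩
instance : Neg (M ⟶ N) := ⟨fun f => ⟨-f.lin, by simp [f.map_act]⟩⟩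
instance : Sub (M ⟶ N) := ⟨fun f g => ⟨f.lin - g.lin, by simp [f.map_act, g.map_act]⟩⟩
instance : SMul ℕ (M ⟶ N) := ⟨fun n f => ⟨n • f.lin, by simp [f.map_act]⟩⟩
instance : SMul ℤ (M ⟶ N) := ⟨fun n f => ⟨n • f.lin, by simp [f.map_act]⟩⟩

theorem lin_injective :
    Function.Injective (fun f : M ⟶ N => (f.lin : M.carrier →ₗ[k] N.carrier)) :=
  fun _ _ w => Hom.ext w

instance : AddCommGroup (M ⟶ N) :=
  (lin_injective M N).addCommGroup _ rfl (fun _ _ => rfl) (fun _ => rfl) (fun _ _ => rfl)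
    (fun _ _ => rfl) (fun _ _ => rfl)

@[simp] theorem add_lin {M N : RightLieModule k h} (f g : M ⟶ N) :
    (f + g).lin = f.lin + g.lin := rfl

end Preadditive

instance : Preadditive (RightLieModule k h) where
  add_comp _ _ _ f f' g := by ext; simp
  comp_add _ _ _ f g g' := by ext; simp

end RightLieModule

/-! ### The category of modules over a Leibniz algebra -/

/-- A module over a Leibniz algebra `g`: a vector space `M` with a left action `x, m ↦ xm` and
a right action `m, x ↦ mx` satisfying the three relations (MLL), (LML) and (LLM). -/
structure LeibnizModule (k g : Type u) [Field k] [AddCommGroup g] [Module k g]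
    [LeibnizAlgebra k g] where
  carrier : Type u
  [addCommGroup : AddCommGroup carrier]
  [module : Module k carrier]
  /-- The left action `x, m ↦ xm`. -/
  l : g →ₗ[k] carrier →ₗ[k] carrier
  /-- The right action `m, x ↦ mx`. -/
  r : carrier →ₗ[k] g →ₗ[k] carrier
  mll : ∀ m x y, r m (LeibnizAlgebra.mul (k := k) x y) = r (r m x) y - r (r m y) x
  lml : ∀ m x y, l x (r m y) = r (l x m) y - l (LeibnizAlgebra.mul (k := k) x y) m
  llm : ∀ m x y, l x (l y m) = l (LeibnizAlgebra.mul (k := k) x y) m - r (l x m) y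

namespace LeibnizModule

variable {k g : Type u} [Field k] [AddCommGroup g] [Module k g] [LeibnizAlgebra k g]

attribute [instance] addCommGroup module

/-- A morphism of `g`-modules: a linear map commuting with the left and right actions. -/
@[ext]
structure Hom (M N : LeibnizModule k g) where
  lin : M.carrier →ₗ[k] N.carrier
  map_l : ∀ x m, lin (M.l x m) = N.l x (lin m)
  map_r : ∀ m x, lin (M.r m x) = N.r (lin m) x

instance : Category (LeibnizModule k g) where
  Hom M N := Hom M N
  id M := ⟨LinearMap.id, fun _ _ => rfl, fun _ _ => rfl⟩
  comp f g := ⟨g.lin ∘ₗ f.lin, fun m x => by simp [f.map_l, g.map_l],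
    fun m x => by simp [f.map_r, g.map_r]⟩

@[ext]
theorem hom_ext {M N : LeibnizModule k g} {f g : M ⟶ N} (w : ∀ m, f.lin m = g.lin m) : f = g :=
  Hom.ext (LinearMap.ext w)

@[simp] theorem id_lin (M : LeibnizModule k g) : Hom.lin (𝟙 M) = LinearMap.id := rfl

@[simp] theorem comp_lin {M N P : LeibnizModule k g} (f : M ⟶ N) (g : N ⟶ P) :
    (f ≫ g).lin = g.lin ∘ₗ f.lin := rfl

section Preadditive

variable (M N : LeibnizModule k g)

instance : Zero (M ⟶ N) := ⟨⟨0, by simp, by simp⟩⟩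
instance : Add (M ⟶ N) := ⟨fun f g => ⟨f.lin + g.lin, by simp [f.map_l, g.map_l],
  by simp [f.map_r, g.map_r]⟩⟩
instance : Neg (M ⟶ N) := ⟨fun f => ⟨-f.lin, by simp [f.map_l], by simp [f.map_r]⟩⟩
instance : Sub (M ⟶ N) := ⟨fun f g => ⟨f.lin - g.lin, by simp [f.map_l, g.map_l],
  by simp [f.map_r, g.map_r]⟩⟩
instance : SMul ℕ (M ⟶ N) := ⟨fun n f => ⟨n • f.lin, by simp [f.map_l], by simp [f.map_r]⟩⟩
instance : SMul ℤ (M ⟶ N) := ⟨fun n f => ⟨n • f.lin, by simp [f.map_l], by simp [f.map_r]⟩⟩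

theorem lin_injective :
    Function.Injective (fun f : M ⟶ N => (f.lin : M.carrier →ₗ[k] N.carrier)) :=
  fun _ _ w => Hom.ext w

instance : AddCommGroup (M ⟶ N) :=
  (lin_injective M N).addCommGroup _ rfl (fun _ _ => rfl) (fun _ => rfl) (fun _ _ => rfl)
    (fun _ _ => rfl) (fun _ _ => rfl)

@[simp] theorem add_lin {M N : LeibnizModule k g} (f g : M ⟶ N) :
    (f + g).lin = f.lin + g.lin := rfl

end Preadditive

instance : Preadditive (LeibnizModule k g) where
  add_comp _ _ _ f f' g := by ext; simp
  comp_add _ _ _ f g g' := by ext; simp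

end LeibnizModule

/-! ### Modules over the enveloping algebras

The two module categories are equivalent to categories of right modules over the enveloping
algebras `U(h)` and `UL(g)`. This shows that they are abelian with enough injectives. A right
module over an algebra `A` is a module over `Aᵐᵒᵖ`. -/

namespace RightLieModule

variable {k h : Type u} [Field k] [LieRing h] [LieAlgebra k h]

attribute [local instance] LieRing.ofAssociativeRing

/-- The action of `U(h)ᵐᵒᵖ` on a right `h`-module. -/
def envHom (M : RightLieModule k h) :
    (UniversalEnvelopingAlgebra k h)ᵐᵒᵖ →ₐ[k] Module.End k M.carrier :=
  AlgHom.opComm (UniversalEnvelopingAlgebra.lift k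
    { toFun := fun x => MulOpposite.op (M.act.flip x)
      map_add' := fun x y => by simp
      map_smul' := fun c x => by simp
      map_lie' := fun {x y} => by
        apply MulOpposite.unop_injective
        ext m
        simp [LieRing.of_associative_ring_bracket, M.act_lie] })

theorem envHom_ι (M : RightLieModule k h) (x : h) (m : M.carrier) :
    M.envHom (MulOpposite.op (UniversalEnvelopingAlgebra.ι k x)) m = M.act m x := by
  simp [envHom, AlgHom.opComm, -UniversalEnvelopingAlgebra.ι_apply,
    UniversalEnvelopingAlgebra.lift_ι_apply]

/-- An underlying right `U(h)`-module. -/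
instance envModule (M : RightLieModule k h) :
    Module (UniversalEnvelopingAlgebra k h)ᵐᵒᵖ M.carrier :=
  Module.compHom M.carrier M.envHom.toRingHom

theorem env_smul (M : RightLieModule k h) (a : (UniversalEnvelopingAlgebra k h)ᵐᵒᵖ)
    (m : M.carrier) : a • m = M.envHom a m := rfl

/-- The universal enveloping algebra is generated by the image of the Lie algebra. -/
theorem env_adjoin :
    Algebra.adjoin k (Set.range (UniversalEnvelopingAlgebra.ι k : h → _)) = ⊤ := by
  set S := Algebra.adjoin k (Set.range (UniversalEnvelopingAlgebra.ι k : h → _)) with hS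
  let F : UniversalEnvelopingAlgebra k h →ₐ[k] S := UniversalEnvelopingAlgebra.lift k
    { toFun := fun x => ⟨UniversalEnvelopingAlgebra.ι k x, Algebra.subset_adjoin ⟨x, rfl⟩⟩
      map_add' := fun x y => Subtype.ext (map_add (UniversalEnvelopingAlgebra.ι k) x y)
      map_smul' := fun c x => Subtype.ext (map_smul (UniversalEnvelopingAlgebra.ι k) c x)
      map_lie' := fun {x y} =>
        Subtype.ext (LieHom.map_lie (UniversalEnvelopingAlgebra.ι k) x y) }
  have hF : S.val.comp F = AlgHom.id k _ := by
    apply UniversalEnvelopingAlgebra.hom_ext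
    apply LieHom.ext
    intro x
    simp [F, -UniversalEnvelopingAlgebra.ι_apply, UniversalEnvelopingAlgebra.lift_ι_apply]
  rw [eq_top_iff]
  intro a _
  have := congrArg (fun φ => φ a) hF
  simp only [AlgHom.comp_apply, AlgHom.id_apply] at this
  rw [← this]
  exact (F a).2

/-- A linear map commuting with the action of `h` commutes with the action of `U(h)`. -/
theorem env_induction {V W : Type*} [AddCommGroup V] [Module k V] [AddCommGroup W] [Module k W]
    (ρ : (UniversalEnvelopingAlgebra k h)ᵐᵒᵖ →ₐ[k] Module.End k V)
    (σ : (UniversalEnvelopingAlgebra k h)ᵐᵒᵖ →ₐ[k] Module.End k W) (f : V →ₗ[k] W)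
    (hf : ∀ x v, f (ρ (MulOpposite.op (UniversalEnvelopingAlgebra.ι k x)) v) =
      σ (MulOpposite.op (UniversalEnvelopingAlgebra.ι k x)) (f v)) (a v) :
    f (ρ a v) = σ a (f v) := by
  induction a using MulOpposite.rec' with | _ a =>
  have ha : a ∈ Algebra.adjoin k (Set.range (UniversalEnvelopingAlgebra.ι k : h → _)) := by
    rw [env_adjoin]; trivial
  induction ha using Algebra.adjoin_induction generalizing v with
  | mem a ha => obtain ⟨x, rfl⟩ := ha; exact hf x v
  | algebraMap c =>
    rw [← MulOpposite.algebraMap_apply, AlgHom.commutes, AlgHom.commutes]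
    simp [Module.algebraMap_end_apply]
  | add a b _ _ iha ihb => simp [iha, ihb]
  | mul a b _ _ iha ihb => simp [iha, ihb]

variable (k h) in
/-- The functor from right `h`-modules to right `U(h)`-modules. -/
def toEnv : RightLieModule k h ⥤ ModuleCat.{u} (UniversalEnvelopingAlgebra k h)ᵐᵒᵖ where
  obj M := ModuleCat.of _ M.carrier
  map {M N} f := ModuleCat.ofHom
    { toFun := f.lin
      map_add' := map_add f.lin
      map_smul' := fun a m => env_induction M.envHom N.envHom f.lin
        (fun x v => by rw [envHom_ι, envHom_ι, f.map_act]) a m }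

instance : (toEnv k h).Faithful where
  map_injective {M N f g} w := by
    ext m
    exact congrArg (fun φ => φ.hom m) w

theorem env_algebraMap_smul (M : RightLieModule k h) (c : k) (m : M.carrier) :
    (algebraMap k (UniversalEnvelopingAlgebra k h)ᵐᵒᵖ c) • m = c • m := by
  rw [env_smul, AlgHom.commutes, Module.algebraMap_end_apply]

instance : (toEnv k h).Full where
  map_surjective {M N} φ := by
    let φ' : M.carrier →ₗ[(UniversalEnvelopingAlgebra k h)ᵐᵒᵖ] N.carrier := φ.hom
    refine ⟨⟨{ toFun := φ', map_add' := map_add φ', map_smul' := fun c m => ?_ }, ?_⟩, ?_⟩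
    · have := φ'.map_smul (algebraMap k _ c) m
      rwa [env_algebraMap_smul, env_algebraMap_smul] at this
    · intro m x
      have := φ'.map_smul (MulOpposite.op (UniversalEnvelopingAlgebra.ι k x)) m
      rwa [env_smul, env_smul, envHom_ι, envHom_ι] at this
    · rfl

/-- The right `h`-module underlying a right `U(h)`-module. -/
def ofEnv (V : ModuleCat.{u} (UniversalEnvelopingAlgebra k h)ᵐᵒᵖ) : RightLieModule k h :=
  letI : Module k V := Module.compHom V (algebraMap k (UniversalEnvelopingAlgebra k h)ᵐᵒᵖ)
  haveI : IsScalarTower k (UniversalEnvelopingAlgebra k h)ᵐᵒᵖ V := ⟨fun c a v => by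
    rw [Algebra.smul_def, mul_smul]; rfl⟩
  haveI : SMulCommClass (UniversalEnvelopingAlgebra k h)ᵐᵒᵖ k V :=
    IsScalarTower.to_smulCommClass'
  { carrier := V
    act := LinearMap.mk₂ k
      (fun v x => MulOpposite.op (UniversalEnvelopingAlgebra.ι k x) • v)
      (fun v w x => smul_add _ _ _) (fun c v x => smul_comm _ _ _)
      (fun v x y => by rw [← add_smul, ← MulOpposite.op_add, ← map_add])
      (fun c v x => by rw [← smul_assoc, ← MulOpposite.op_smul, ← map_smul])
    act_lie := fun v x y => by
      simp [LieRing.of_associative_ring_bracket, sub_smul, mul_smul,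
        -UniversalEnvelopingAlgebra.ι_apply] }

instance : (toEnv k h).EssSurj where
  mem_essImage V := by
    let _ : Module k V := Module.compHom V (algebraMap k (UniversalEnvelopingAlgebra k h)ᵐᵒᵖ)
    have : IsScalarTower k (UniversalEnvelopingAlgebra k h)ᵐᵒᵖ V := ⟨fun c a v => by
      rw [Algebra.smul_def, mul_smul]; rfl⟩
    refine ⟨ofEnv V, ⟨LinearEquiv.toModuleIso (X₁ := (ofEnv V).carrier) (X₂ := V)
      { toFun := fun v => v
        invFun := fun v => v
        map_add' := fun _ _ => rfl
        map_smul' := fun a v => ?_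
        left_inv := fun _ => rfl
        right_inv := fun _ => rfl }⟩⟩
    exact env_induction (ofEnv V).envHom (Algebra.lsmul k k V) (LinearMap.id (M := V))
      (fun x v => (envHom_ι (ofEnv V) x v).trans rfl) a v

instance : (toEnv k h).IsEquivalence where

instance : Limits.HasFiniteProducts (RightLieModule k h) :=
  ⟨fun _ => Adjunction.hasLimitsOfShape_of_equivalence (toEnv k h)⟩

noncomputable instance : Abelian (RightLieModule k h) := abelianOfEquivalence (toEnv k h)

end RightLieModule

namespace LeibnizAlgebra

variable (k g : Type u) [Field k] [AddCommGroup g] [Module k g] [LeibnizAlgebra k g]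

/-- The relations defining `UL(g)`, on the tensor algebra of `gˡ ⊕ gʳ`, with `l_x = (x, 0)` and
`r_x = (0, x)`: `r_{xy} = [r_x, r_y]`, `l_{xy} = [l_x, r_y]` and `(r_x + l_x) l_y = 0`. -/
inductive ULRel : TensorAlgebra k (g × g) → TensorAlgebra k (g × g) → Prop
  | r_mul (x y : g) : ULRel (TensorAlgebra.ι k (0, mul (k := k) x y))
      (TensorAlgebra.ι k (0, x) * TensorAlgebra.ι k (0, y) -
        TensorAlgebra.ι k (0, y) * TensorAlgebra.ι k (0, x))
  | l_mul (x y : g) : ULRel (TensorAlgebra.ι k (mul (k := k) x y, 0))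
      (TensorAlgebra.ι k (x, 0) * TensorAlgebra.ι k (0, y) -
        TensorAlgebra.ι k (0, y) * TensorAlgebra.ι k (x, 0))
  | r_add_l (x y : g) : ULRel
      ((TensorAlgebra.ι k (0, x) + TensorAlgebra.ι k (x, 0)) * TensorAlgebra.ι k (y, 0)) 0

/-- The universal enveloping algebra `UL(g)` of a Leibniz algebra. -/
abbrev UL : Type u := RingQuot (ULRel k g)

/-- The generator `l_x + r_y` of `UL(g)`. -/
def ulGen : g × g →ₗ[k] UL k g :=
  (RingQuot.mkAlgHom k (ULRel k g)).toLinearMap ∘ₗ TensorAlgebra.ι k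

theorem ulGen_apply (p : g × g) :
    ulGen k g p = RingQuot.mkAlgHom k (ULRel k g) (TensorAlgebra.ι k p) := rfl

end LeibnizAlgebra

namespace LeibnizModule

open LeibnizAlgebra

variable {k g : Type u} [Field k] [AddCommGroup g] [Module k g] [LeibnizAlgebra k g]

/-- The action of `UL(g)ᵐᵒᵖ` on a `g`-module: `m l_x = xm` and `m r_x = mx`. -/
def envHom (M : LeibnizModule k g) : (UL k g)ᵐᵒᵖ →ₐ[k] Module.End k M.carrier :=
  AlgHom.opComm (RingQuot.liftAlgHom k
    ⟨TensorAlgebra.lift k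
      { toFun := fun p : g × g => MulOpposite.op (M.l p.1 + M.r.flip p.2)
        map_add' := fun p q => by
          apply MulOpposite.unop_injective; ext m; simp; abel
        map_smul' := fun c p => by
          apply MulOpposite.unop_injective; ext m; simp }, by
      intro a b hab
      apply MulOpposite.unop_injective
      ext m
      cases hab with
      | r_mul x y => simp [M.mll]
      | l_mul x y => simp [M.lml]
      | r_add_l x y => simp [M.lml, M.llm]⟩)

theorem envHom_gen (M : LeibnizModule k g) (p : g × g) (m : M.carrier) :
    M.envHom (MulOpposite.op (ulGen k g p)) m = M.l p.1 m + M.r m p.2 := by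
  simp [envHom, AlgHom.opComm, ulGen_apply]

instance envModule (M : LeibnizModule k g) : Module (UL k g)ᵐᵒᵖ M.carrier :=
  Module.compHom M.carrier M.envHom.toRingHom

theorem env_smul (M : LeibnizModule k g) (a : (UL k g)ᵐᵒᵖ)
    (m : M.carrier) : a • m = M.envHom a m := rfl

/-- A linear map commuting with the generators commutes with the action of `UL(g)`. -/
theorem env_induction {V W : Type*} [AddCommGroup V] [Module k V] [AddCommGroup W] [Module k W]
    (ρ : (UL k g)ᵐᵒᵖ →ₐ[k] Module.End k V) (σ : (UL k g)ᵐᵒᵖ →ₐ[k] Module.End k W)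
    (f : V →ₗ[k] W)
    (hf : ∀ p v, f (ρ (MulOpposite.op (ulGen k g p)) v) =
      σ (MulOpposite.op (ulGen k g p)) (f v)) (a v) :
    f (ρ a v) = σ a (f v) := by
  induction a using MulOpposite.rec' with | _ a =>
  obtain ⟨a, rfl⟩ := RingQuot.mkAlgHom_surjective k (ULRel k g) a
  induction a using TensorAlgebra.induction generalizing v with
  | ι p => exact hf p v
  | algebraMap c =>
    rw [AlgHom.commutes, ← MulOpposite.algebraMap_apply, AlgHom.commutes, AlgHom.commutes]
    simp [Module.algebraMap_end_apply]
  | add a b iha ihb => simp [iha, ihb]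
  | mul a b iha ihb => simp [iha, ihb]

variable (k g) in
/-- The functor from `g`-modules to right `UL(g)`-modules. -/
def toEnv : LeibnizModule k g ⥤ ModuleCat.{u} (UL k g)ᵐᵒᵖ where
  obj M := ModuleCat.of _ M.carrier
  map {M N} f := ModuleCat.ofHom
    { toFun := f.lin
      map_add' := map_add f.lin
      map_smul' := fun a m => env_induction M.envHom N.envHom f.lin
        (fun x v => by simp [envHom_gen, f.map_l, f.map_r]) a m }

instance : (toEnv k g).Faithful where
  map_injective {M N f g} w := by
    ext m
    exact congrArg (fun φ => φ.hom m) w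

theorem env_algebraMap_smul (M : LeibnizModule k g) (c : k) (m : M.carrier) :
    (algebraMap k (UL k g)ᵐᵒᵖ c) • m = c • m := by
  rw [env_smul, AlgHom.commutes, Module.algebraMap_end_apply]

instance : (toEnv k g).Full where
  map_surjective {M N} φ := by
    let φ' : M.carrier →ₗ[(UL k g)ᵐᵒᵖ] N.carrier := φ.hom
    refine ⟨⟨{ toFun := φ', map_add' := map_add φ', map_smul' := fun c m => ?_ }, ?_, ?_⟩, ?_⟩
    · have := φ'.map_smul (algebraMap k _ c) m
      rwa [env_algebraMap_smul, env_algebraMap_smul] at this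
    · intro x m
      have := φ'.map_smul (MulOpposite.op (ulGen k g (x, 0))) m
      rw [env_smul, env_smul, envHom_gen, envHom_gen] at this
      simpa using this
    · intro m x
      have := φ'.map_smul (MulOpposite.op (ulGen k g (0, x))) m
      rw [env_smul, env_smul, envHom_gen, envHom_gen] at this
      simpa using this
    · rfl

theorem ulGen_r_mul (x y : g) : ulGen k g (0, mul (k := k) x y) =
    ulGen k g (0, x) * ulGen k g (0, y) - ulGen k g (0, y) * ulGen k g (0, x) := by
  simp only [ulGen_apply, ← map_mul, ← map_sub]
  exact RingQuot.mkAlgHom_rel k (ULRel.r_mul x y)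

theorem ulGen_l_mul (x y : g) : ulGen k g (mul (k := k) x y, 0) =
    ulGen k g (x, 0) * ulGen k g (0, y) - ulGen k g (0, y) * ulGen k g (x, 0) := by
  simp only [ulGen_apply, ← map_mul, ← map_sub]
  exact RingQuot.mkAlgHom_rel k (ULRel.l_mul x y)

theorem ulGen_r_add_l (x y : g) :
    (ulGen k g (0, x) + ulGen k g (x, 0)) * ulGen k g (y, 0) = 0 := by
  have := RingQuot.mkAlgHom_rel k (ULRel.r_add_l (k := k) x y)
  simpa [ulGen_apply] using this

/-- The `g`-module underlying a right `UL(g)`-module. -/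
def ofEnv (V : ModuleCat.{u} (UL k g)ᵐᵒᵖ) : LeibnizModule k g :=
  letI : Module k V := Module.compHom V (algebraMap k (UL k g)ᵐᵒᵖ)
  haveI : IsScalarTower k (UL k g)ᵐᵒᵖ V := ⟨fun c a v => by
    rw [Algebra.smul_def, mul_smul]; rfl⟩
  haveI : SMulCommClass (UL k g)ᵐᵒᵖ k V := IsScalarTower.to_smulCommClass'
  { carrier := V
    l := LinearMap.mk₂ k
      (fun x v => MulOpposite.op (ulGen k g (x, 0)) • v)
      (fun x y v => by rw [← add_smul, ← MulOpposite.op_add, ← map_add]; simp)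
      (fun c x v => by rw [← smul_assoc, ← MulOpposite.op_smul, ← map_smul]; simp)
      (fun x v w => smul_add _ _ _) (fun c x v => smul_comm _ _ _)
    r := LinearMap.mk₂ k
      (fun v x => MulOpposite.op (ulGen k g (0, x)) • v)
      (fun v w x => smul_add _ _ _) (fun c v x => smul_comm _ _ _)
      (fun v x y => by rw [← add_smul, ← MulOpposite.op_add, ← map_add]; simp)
      (fun c v x => by rw [← smul_assoc, ← MulOpposite.op_smul, ← map_smul]; simp)
    mll := fun v x y => by
      simp [ulGen_r_mul, sub_smul, mul_smul]
    lml := fun v x y => by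
      simp [ulGen_l_mul, sub_smul, mul_smul]
    llm := fun v x y => by
      have h := congrArg (fun a => MulOpposite.op a • v) (ulGen_r_add_l (k := k) y x)
      simp only [add_mul, MulOpposite.op_add, MulOpposite.op_mul, add_smul, mul_smul,
        MulOpposite.op_zero, zero_smul] at h
      simp only [LinearMap.mk₂_apply, ulGen_l_mul, MulOpposite.op_sub, MulOpposite.op_mul,
        sub_smul, mul_smul]
      rw [eq_neg_of_add_eq_zero_right h]
      abel }

instance : (toEnv k g).EssSurj where
  mem_essImage V := by
    let _ : Module k V := Module.compHom V (algebraMap k (UL k g)ᵐᵒᵖ)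
    have : IsScalarTower k (UL k g)ᵐᵒᵖ V := ⟨fun c a v => by
      rw [Algebra.smul_def, mul_smul]; rfl⟩
    refine ⟨ofEnv V, ⟨LinearEquiv.toModuleIso (X₁ := (ofEnv V).carrier) (X₂ := V)
      { toFun := fun v => v
        invFun := fun v => v
        map_add' := fun _ _ => rfl
        map_smul' := fun a v => ?_
        left_inv := fun _ => rfl
        right_inv := fun _ => rfl }⟩⟩
    refine env_induction (ofEnv V).envHom (Algebra.lsmul k k V) (LinearMap.id (M := V))
      (fun p v => ?_) a v
    refine (envHom_gen (ofEnv V) p v).trans ?_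
    have h : ulGen k g p = ulGen k g (p.1, 0) + ulGen k g (0, p.2) := by
      rw [← map_add]; simp
    rw [h, MulOpposite.op_add, map_add]
    rfl

instance : (toEnv k g).IsEquivalence where

instance : Limits.HasFiniteProducts (LeibnizModule k g) :=
  ⟨fun _ => Adjunction.hasLimitsOfShape_of_equivalence (toEnv k g)⟩

noncomputable instance : Abelian (LeibnizModule k g) := abelianOfEquivalence (toEnv k g)

instance : EnoughInjectives (LeibnizModule k g) := EnoughInjectives.of_equivalence (toEnv k g)

/-! ### Antisymmetric invariants and the functor `rext` -/

/-- The right action of `g_Lie` on a `g`-module, induced by the right action of `g`. -/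
def lieAct (M : LeibnizModule k g) : M.carrier →ₗ[k] Lie k g →ₗ[k] M.carrier :=
  (lieDesc k g M.r.flip (fun x => by ext m; simp [M.mll])).flip

theorem lieAct_toLie (M : LeibnizModule k g) (m : M.carrier) (x : g) :
    M.lieAct m (toLie k g x) = M.r m x := rfl

theorem lieAct_lie (M : LeibnizModule k g) (m : M.carrier) (x y : Lie k g) :
    M.lieAct m ⁅x, y⁆ = M.lieAct (M.lieAct m x) y - M.lieAct (M.lieAct m y) x := by
  obtain ⟨x, rfl⟩ := toLie_surjective k g x
  obtain ⟨y, rfl⟩ := toLie_surjective k g y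
  rw [toLie_mul]
  exact M.mll m x y

variable (k g) in
/-- The antisymmetric `g`-module `Nᵃ` associated to a right `g_Lie`-module `N`: the right
action is that of `N`, the left action is zero. -/
def antisym : RightLieModule k (Lie k g) ⥤ LeibnizModule k g where
  obj N :=
    { carrier := N.carrier
      l := 0
      r := N.act.compl₂ (toLie k g)
      mll := fun m x y => by simp [← toLie_mul, N.act_lie]
      lml := fun m x y => by simp
      llm := fun m x y => by simp }
  map f := ⟨f.lin, fun _ _ => by simp, fun m x => f.map_act m (toLie k g x)⟩

/-- The subspace `{m | xm = 0 for all x}` of a `g`-module `M`. -/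
def invariants (M : LeibnizModule k g) : Submodule k M.carrier where
  carrier := {m | ∀ x, M.l x m = 0}
  add_mem' ha hb x := by simp [ha x, hb x]
  zero_mem' x := by simp
  smul_mem' c m hm x := by simp [hm x]

theorem act_mem_invariants (M : LeibnizModule k g) (m : M.invariants) (x : Lie k g) :
    M.lieAct m.1 x ∈ M.invariants := by
  obtain ⟨x, rfl⟩ := toLie_surjective k g x
  intro y
  rw [lieAct_toLie, M.lml, m.2 y, m.2]
  simp

/-- The right `g_Lie`-module `{m | xm = 0 for all x}`, with the right action of `M`. -/
def asinvObj (M : LeibnizModule k g) : RightLieModule k (Lie k g) where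
  carrier := M.invariants
  act := LinearMap.mk₂ k
    (fun m x => (⟨M.lieAct m.1 x, act_mem_invariants M m x⟩ : M.invariants))
    (fun _ _ _ => by ext; simp) (fun _ _ _ => by ext; simp)
    (fun _ _ _ => by ext; simp) (fun _ _ _ => by ext; simp)
  act_lie m x y := Subtype.ext (M.lieAct_lie m.1 x y)

/-- The restriction of a morphism to the invariants. -/
def invariantsMap {M N : LeibnizModule k g} (f : M ⟶ N) : M.invariants →ₗ[k] N.invariants :=
  LinearMap.restrict f.lin (fun m hm x => by rw [← f.map_l, hm x, map_zero])

theorem invariantsMap_act {M N : LeibnizModule k g} (f : M ⟶ N) (m : M.invariants)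
    (x : Lie k g) : invariantsMap f (M.asinvObj.act m x) = N.asinvObj.act (invariantsMap f m) x := by
  obtain ⟨x, rfl⟩ := toLie_surjective k g x
  exact Subtype.ext (p := fun n => n ∈ N.invariants) (f.map_r m.1 x)

variable (k g) in
/-- The antisymmetric invariants functor: it sends a `g`-module `M` to the right `g_Lie`-module
`{m | xm = 0 for all x}`. -/
def asinv : LeibnizModule k g ⥤ RightLieModule k (Lie k g) where
  obj M := M.asinvObj
  map f := ⟨invariantsMap f, invariantsMap_act f⟩

instance : (asinv k g).Additive where
  map_add := rfl

/-- The antisymmetric invariants functor is right adjoint to `N ↦ Nᵃ`. -/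
def antisymAsinvAdjunction : antisym k g ⊣ asinv k g :=
  Adjunction.mkOfHomEquiv
    { homEquiv := fun N M =>
        { toFun := fun f =>
            { lin := LinearMap.codRestrict M.invariants f.lin (fun n x =>
                (f.map_l x n).symm.trans (map_zero f.lin))
              map_act := fun n x => by
                obtain ⟨x, rfl⟩ := toLie_surjective k g x
                apply Subtype.ext (p := fun m => m ∈ M.invariants)
                exact f.map_r n x }
          invFun := fun f =>
            { lin := M.invariants.subtype ∘ₗ f.lin
              map_l := fun x n => (map_zero _).trans ((f.lin n).2 x).symm
              map_r := fun n x => congrArg Subtype.val (f.map_act n (toLie k g x)) }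
          left_inv := fun _ => rfl
          right_inv := fun _ => rfl }
      homEquiv_naturality_left_symm := fun _ _ => rfl
      homEquiv_naturality_right := fun _ _ => rfl }

/-- The diagonal right action on `hom_k(g↓, N)`: `(fx)(y) = f(y)x - f(yx)`. -/
def homAct (N : RightLieModule k (Lie k g)) :
    (g →ₗ[k] N.carrier) →ₗ[k] g →ₗ[k] (g →ₗ[k] N.carrier) :=
  LinearMap.mk₂ k
    (fun f x => N.act.flip (toLie k g x) ∘ₗ f - f ∘ₗ (mul (k := k)).flip x)
    (fun f f' x => by ext y; simp; abel)
    (fun c f x => by ext y; simp [smul_sub])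
    (fun f x x' => by ext y; simp; abel)
    (fun c f x => by ext y; simp [smul_sub])

theorem homAct_apply (N : RightLieModule k (Lie k g)) (f : g →ₗ[k] N.carrier) (x y : g) :
    homAct N f x y = N.act (f y) (toLie k g x) - f (mul (k := k) y x) := rfl

theorem homAct_mul (N : RightLieModule k (Lie k g)) (f : g →ₗ[k] N.carrier) (x y : g) :
    homAct N f (mul (k := k) x y) = homAct N (homAct N f x) y - homAct N (homAct N f y) x := by
  ext z
  simp only [homAct_apply, LinearMap.sub_apply, ← toLie_mul, N.act_lie, leibniz, map_sub]
  abel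

variable (k g) in
/-- The universal extension `0 → Nᵃ → rext N → hom_k(g↓, N)ˢ → 0`. Its elements are the pairs
`(n, f)` with `n ∈ N` and `f : g → N` linear, with the right action `(n, f)x = (nx, fx)` (so that
`(rext N)↓ = N ⊕ hom_k(g↓, N)`) and the left action `x(n, f) = (f(x), -fx)`, given by the
evaluation map and by the symmetric module structure on `hom_k(g↓, N)`. -/
def rext : RightLieModule k (Lie k g) ⥤ LeibnizModule k g where
  obj N :=
    { carrier := N.carrier × (g →ₗ[k] N.carrier)
      l := LinearMap.mk₂ k (fun x p => (p.2 x, -homAct N p.2 x))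
        (fun _ _ _ => by ext <;> simp [add_comm]) (fun _ _ _ => by ext <;> simp)
        (fun _ _ _ => by ext <;> simp [add_comm]) (fun _ _ _ => by ext <;> simp)
      r := LinearMap.mk₂ k (fun p x => (N.act p.1 (toLie k g x), homAct N p.2 x))
        (fun _ _ _ => by ext <;> simp) (fun _ _ _ => by ext <;> simp)
        (fun _ _ _ => by ext <;> simp) (fun _ _ _ => by ext <;> simp)
      mll := fun p x y => by
        ext1
        · simp [← toLie_mul, N.act_lie]
        · simp [homAct_mul]
      lml := fun p x y => by
        ext1
        · simp [homAct_apply]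
        · simp [homAct_mul]; abel
      llm := fun p x y => by
        ext1
        · simp [homAct_apply]
        · simp [homAct_mul] }
  map {N N'} f :=
    { lin := f.lin.prodMap (LinearMap.compRight k f.lin)
      map_l := fun x p => by
        ext1
        · rfl
        · ext y; simp [homAct_apply, f.map_act]
      map_r := fun p x => by
        ext1
        · simp [f.map_act]
        · ext y; simp [homAct_apply, f.map_act] }
  map_id N := rfl
  map_comp f f' := rfl

end LeibnizModule

/-! The functor `rext` has three properties that together force the result: it is exact, it
preserves injectives, and its composite with `asinv` is the identity. Apply `rext` to an injective
resolution `I` of `N`. By the first two properties this is an injective resolution of `rext N`, so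
its image under `asinv` computes the derived functors. By the third that image is `I` again, which
is exact in positive degrees (`isZero_rightDerived_obj_of_comp_iso_id`).

The first two properties come from `forgetLeftRextAdjunction`: `rext` is right adjoint to forgetting
the left action. The left adjoint keeps underlying linear maps, hence preserves monomorphisms, so
`rext` preserves injectives; as a right adjoint, `rext` also preserves kernels. Preservation of
epimorphisms is where the field enters: a surjection of vector spaces splits linearly, so `hom_k(g,
-)` keeps it surjective. The third property is `rextAsinvIso`: the first coordinate of `x(n, f)` is
`f(x)`, so an invariant pair has `f = 0`.

In degree zero, left exactness of `asinv` identifies its zeroth derived functor with `asinv` itself.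
-/

open Limits

/-! ### Derived functors along an exact functor that preserves injectives. -/

section DerivedFunctors

universe v₁ v₂ v₃ u₁ u₂ u₃

variable {C : Type u₁} [Category.{v₁} C] {D : Type u₂} [Category.{v₂} D] {E : Type u₃}
  [Category.{v₃} E] [Abelian C] [Abelian D] [Abelian E]

/-- An additive functor which preserves homology and injective objects sends an injective
resolution of `Z` to an injective resolution of the image of `Z`. -/
noncomputable def mapInjectiveResolution (G : C ⥤ D) [G.Additive] [G.PreservesInjectiveObjects]
    [G.PreservesHomology] {Z : C} (I : InjectiveResolution Z) :
    InjectiveResolution (G.obj Z) where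
  cocomplex := (G.mapHomologicalComplex _).obj I.cocomplex
  injective n := Functor.PreservesInjectiveObjects.injective_obj (I.injective n)
  ι := (HomologicalComplex.singleMapHomologicalComplex _ _ _).inv.app _ ≫
    (G.mapHomologicalComplex _).map I.ι
  -- Exactness of `G` makes the image of `I.ι` a quasi-isomorphism, and the other factor is an
  -- isomorphism.
  quasiIso := inferInstance

/-- If `G` is exact and preserves injective objects and `G ⋙ F` is isomorphic to the identity,
then the higher right derived functors of `F` vanish on the image of `G`. -/
theorem isZero_rightDerived_obj_of_comp_iso_id [HasInjectiveResolutions C]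
    [HasInjectiveResolutions D] (G : C ⥤ D) [G.Additive] [G.PreservesInjectiveObjects]
    [G.PreservesHomology] (F : D ⥤ C) [F.Additive] (e : G ⋙ F ≅ 𝟭 C) (X : C) {n : ℕ}
    (hn : 0 < n) : IsZero ((F.rightDerived n).obj (G.obj X)) := by
  obtain ⟨n, rfl⟩ := Nat.exists_eq_succ_of_ne_zero hn.ne'
  let I := injectiveResolution X
  -- Any injective resolution computes the derived functor, so the image of `I` under `G` may be
  -- used.
  refine IsZero.of_iso ?_ ((mapInjectiveResolution G I).isoRightDerivedObj F (n + 1))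
  -- Naturality of `e` with respect to the differentials turns its components into an isomorphism of
  -- complexes.
  let e' : (F.mapHomologicalComplex (ComplexShape.up ℕ)).obj
      ((G.mapHomologicalComplex _).obj I.cocomplex) ≅ I.cocomplex :=
    HomologicalComplex.Hom.isoOfComponents (fun i => e.app (I.cocomplex.X i))
      (fun i j _ => (e.hom.naturality (I.cocomplex.d i j)).symm)
  refine IsZero.of_iso ?_ ((HomologicalComplex.homologyFunctor C _ (n + 1)).mapIso e')
  exact (I.cocomplex_exactAt_succ n).isZero_homology

end DerivedFunctors

/-! ### Injectives, epimorphisms and monomorphisms of right Lie modules. -/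

namespace RightLieModule

variable {k h : Type u} [Field k] [LieRing h] [LieAlgebra k h]

/-- Supplies the resolutions of `N` to which `rext` is applied. -/
instance : EnoughInjectives (RightLieModule k h) := EnoughInjectives.of_equivalence (toEnv k h)

theorem surjective_of_epi {M N : RightLieModule k h} (f : M ⟶ N) [Epi f] :
    Function.Surjective f.lin :=
  (ModuleCat.epi_iff_surjective ((toEnv k h).map f)).1 inferInstance

theorem mono_of_injective {M N : RightLieModule k h} (f : M ⟶ N)
    (hf : Function.Injective f.lin) : Mono f :=
  (toEnv k h).mono_of_mono_map ((ModuleCat.mono_iff_injective ((toEnv k h).map f)).2 hf)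

end RightLieModule

/-! ### Monomorphisms and epimorphisms of Leibniz modules. -/

namespace LeibnizModule

open LeibnizAlgebra

variable {k g : Type u} [Field k] [AddCommGroup g] [Module k g] [LeibnizAlgebra k g]

theorem injective_of_mono {M N : LeibnizModule k g} (f : M ⟶ N) [Mono f] :
    Function.Injective f.lin :=
  (ModuleCat.mono_iff_injective ((toEnv k g).map f)).1 inferInstance

theorem epi_of_surjective {M N : LeibnizModule k g} (f : M ⟶ N)
    (hf : Function.Surjective f.lin) : Epi f :=
  (toEnv k g).epi_of_epi_map ((ModuleCat.epi_iff_surjective ((toEnv k g).map f)).2 hf)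

/-! ### The adjunction between forgetting the left action and `rext`. -/

variable (k g) in
/-- The functor which forgets the left action of a `g`-module. -/
def forgetLeft : LeibnizModule k g ⥤ RightLieModule k (Lie k g) where
  obj M := { carrier := M.carrier, act := M.lieAct, act_lie := M.lieAct_lie }
  map f := ⟨f.lin, fun m x => by
    obtain ⟨x, rfl⟩ := toLie_surjective k g x
    exact f.map_r m x⟩

instance : (forgetLeft k g).PreservesMonomorphisms where
  preserves f _ := RightLieModule.mono_of_injective _ (injective_of_mono f)

/-- The morphism `M ⟶ rext N`, `m ↦ (a m, x ↦ a (xm))` induced by a morphism `a` of right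
`g_Lie`-modules. -/
def toRext {M : LeibnizModule k g} {N : RightLieModule k (Lie k g)}
    (a : (forgetLeft k g).obj M ⟶ N) : M ⟶ (rext k g).obj N :=
  letI a' : M.carrier →ₗ[k] N.carrier := a.lin
  have ha : ∀ m x, a' (M.r m x) = N.act (a' m) (toLie k g x) := fun m x => a.map_act m (toLie k g x)
  { lin := LinearMap.prod a' (M.l.flip.compr₂ a')
    map_l := fun x m => by
      refine Prod.ext rfl (LinearMap.ext fun y => ?_)
      change a' (M.l y (M.l x m)) =
        -(N.act (a' (M.l y m)) (toLie k g x) - a' (M.l (mul (k := k) y x) m))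
      -- The relation (LLM), `y(xm) = (yx)m - (ym)x`, is what produces the sign in the left action
      -- `-fx`.
      rw [M.llm, map_sub, ha]
      abel
    map_r := fun m x => by
      refine Prod.ext (ha m x) (LinearMap.ext fun y => ?_)
      change a' (M.l y (M.r m x)) =
        N.act (a' (M.l y m)) (toLie k g x) - a' (M.l (mul (k := k) y x) m)
      -- The relation (LML), `y(mx) = (ym)x - (yx)m`, matches the diagonal action on `hom_k(g, N)`.
      rw [M.lml, map_sub, ha] }

/-- The functor `rext` is right adjoint to the functor which forgets the left action. -/
def forgetLeftRextAdjunction : forgetLeft k g ⊣ rext k g :=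
  Adjunction.mkOfHomEquiv
    { homEquiv := fun M N =>
        { toFun := toRext
          invFun := fun f =>
            { lin := LinearMap.fst k N.carrier (g →ₗ[k] N.carrier) ∘ₗ f.lin
              map_act := fun m x => by
                obtain ⟨x, rfl⟩ := toLie_surjective k g x
                exact congrArg Prod.fst (f.map_r m x) }
          left_inv := fun _ => rfl
          right_inv := fun f => by
            ext m
            refine Prod.ext rfl (LinearMap.ext fun x => ?_)
            -- The second coordinate of `f m` is determined by the first one: its value at `x` is
            -- the first coordinate of `x(f m) = f(xm)`.
            exact congrArg Prod.fst (f.map_l x m) }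
      homEquiv_naturality_left_symm := fun _ _ => rfl
      homEquiv_naturality_right := fun _ _ => rfl }

/-! ### Exactness of `rext` and preservation of injectives. -/

instance : (rext k g).Additive where
  map_add {_ _ f f'} := by
    ext p
    exact Prod.ext rfl (LinearMap.ext fun _ => rfl)

instance : (rext k g).PreservesEpimorphisms where
  preserves {N N'} f _ := by
    refine epi_of_surjective _ fun p => ?_
    -- The section `s` is only `k`-linear. This suffices, since it serves to lift elements of `rext
    -- N'` and not morphisms.
    obtain ⟨s, hs⟩ := f.lin.exists_rightInverse_of_surjective
      (LinearMap.range_eq_top.2 (RightLieModule.surjective_of_epi f))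
    refine ⟨(s p.1, s ∘ₗ p.2), Prod.ext ?_ (LinearMap.ext fun x => ?_)⟩
    · exact LinearMap.congr_fun hs p.1
    · exact LinearMap.congr_fun hs (p.2 x)

/-- Kernels are preserved because `rext` is a right adjoint; together with epimorphisms this gives
exactness. -/
instance : (rext k g).PreservesHomology := by
  have := (forgetLeftRextAdjunction (k := k) (g := g)).rightAdjoint_preservesLimits
  exact (rext k g).preservesHomology_of_preservesEpis_and_kernels

/-- Right adjoint to a functor that preserves monomorphisms. -/
instance : (rext k g).PreservesInjectiveObjects where
  injective_obj h := (forgetLeftRextAdjunction (k := k) (g := g)).map_injective _ h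

/-! ### The antisymmetric invariants of `rext N`. -/

theorem mem_invariants_rext {N : RightLieModule k (Lie k g)}
    (p : N.carrier × (g →ₗ[k] N.carrier)) :
    p ∈ invariants ((rext k g).obj N) ↔ p.2 = 0 := by
  -- The first coordinate of `x(n, f) = 0` already reads `f(x) = 0`.
  refine ⟨fun h => LinearMap.ext fun x => congrArg Prod.fst (h x), fun h x => ?_⟩
  change (p.2 x, -homAct N p.2 x) = 0
  simp [h]

variable (k g) in
/-- The antisymmetric invariants of `rext N` are `N`. -/
def rextAsinvIso : rext k g ⋙ asinv k g ≅ 𝟭 (RightLieModule k (Lie k g)) :=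
  NatIso.ofComponents
    (fun N =>
      { hom :=
          { lin := LinearMap.fst k N.carrier (g →ₗ[k] N.carrier) ∘ₗ
              (invariants ((rext k g).obj N)).subtype
            map_act := fun m x => by
              obtain ⟨x, rfl⟩ := toLie_surjective k g x
              rfl }
        inv :=
          { lin := LinearMap.codRestrict (invariants ((rext k g).obj N))
              (LinearMap.inl k N.carrier (g →ₗ[k] N.carrier))
              (fun n => (mem_invariants_rext _).2 rfl)
            map_act := fun n x => by
              obtain ⟨x, rfl⟩ := toLie_surjective k g x
              apply Subtype.ext (p := fun m => m ∈ invariants ((rext k g).obj N))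
              refine Prod.ext rfl ?_
              change 0 = homAct N 0 x
              simp }
        hom_inv_id := by
          ext m
          apply Subtype.ext (p := fun m => m ∈ invariants ((rext k g).obj N))
          exact Prod.ext rfl ((mem_invariants_rext _).1 m.2).symm
        inv_hom_id := rfl })
    (fun _ => rfl)

/-- Left exactness, from the adjunction with `antisym`; the degree-zero case rests on it. -/
instance : PreservesFiniteLimits (asinv k g) :=
  have := (antisymAsinvAdjunction (k := k) (g := g)).rightAdjoint_preservesLimits
  inferInstance

end LeibnizModule

theorem proposition6p5 (k g : Type u) [Field k] [AddCommGroup g] [Module k g]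
    [LeibnizAlgebra k g] :
    Nonempty (LeibnizModule.rext k g ⋙ (LeibnizModule.asinv k g).rightDerived 0 ≅
      𝟭 (RightLieModule k (LeibnizAlgebra.Lie k g))) ∧
    ∀ n : ℕ, 0 < n → ∀ N : RightLieModule k (LeibnizAlgebra.Lie k g),
      Limits.IsZero (((LeibnizModule.asinv k g).rightDerived n).obj
        ((LeibnizModule.rext k g).obj N)) :=
  -- Composing isomorphisms of functors makes the identification natural in `N`.
  ⟨⟨Functor.isoWhiskerLeft _ (Functor.rightDerivedZeroIsoSelf _) ≪≫
      LeibnizModule.rextAsinvIso k g⟩,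
    fun _ hn N => isZero_rightDerived_obj_of_comp_iso_id _ _ (LeibnizModule.rextAsinvIso k g) N hn⟩
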